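/- Conventions. A quandle is a set $Q$ with binary operations $*,\backslash$ such that $x*(x\backslash y)=y=x\backslash(x*y)$, $x*(y*z)=(x*y)*(x*z)$ and $x*x=x$ for all $x,y,z\in Q$. It is faithful if the left multiplications $L_x:y\mapsto x*y$ are pairwise distinct (i.e. $L_x=L_y$ implies $x=y$), and superfaithful if every subalgebra (subset closed under $*$ and $\backslash$, with the restricted operations) is faithful. For a group $G$, $\theta\in\mathrm{Aut}(G)$ and an integer $t\ge 1$, let $\theta_t\in\mathrm{Aut}(G^t)$ be given by $\theta_t(x_1,\dots,x_t)=(\theta(x_t),x_1,\dots,x_{t-1})$ and let $H_t=\mathrm{Fix}(\theta_t)=\{z\in G^t:\theta_t(z)=z\}$. Then $(G,t,\theta)$ denotes the quandle on the set of left cosets $G^t/H_t$ with the operation $xH_t*yH_t=x\,\theta_t(x^{-1}y)\,H_t$. Proposition. Let $n>5$ and $t\ge 1$ be integers, let $A_n$ be the alternating group of degree $n$, let $\theta\in\mathrm{Aut}(A_n)$, and let $Q=(A_n,t,\theta)$. The following are equivalent: (i) $Q$ is superfaithful; (ii) $\theta=1$ and $\gcd(t,n!)=1$. -/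

import Mathlib

open scoped Quandles

/-- A subalgebra of a rack: a subset closed under both operations `*` and `\`. -/
structure Subrack (R : Type*) [Rack R] where
  carrier : Set R
  act_mem : ∀ {x y : R}, x ∈ carrier → y ∈ carrier → x ◃ y ∈ carrier
  invAct_mem : ∀ {x y : R}, x ∈ carrier → y ∈ carrier → x ◃⁻¹ y ∈ carrier

/-- A subalgebra of a rack is a rack under the restricted operations. -/
instance Subrack.instRack {R : Type*} [Rack R] (S : Subrack R) : Rack S.carrier where
  act x y := ⟨x.1 ◃ y.1, S.act_mem x.2 y.2⟩
  self_distrib := Subtype.ext Shelf.self_distrib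
  invAct x y := ⟨x.1 ◃⁻¹ y.1, S.invAct_mem x.2 y.2⟩
  left_inv x y := Subtype.ext (Rack.left_inv x.1 y.1)
  right_inv x y := Subtype.ext (Rack.right_inv x.1 y.1)

/-- A rack is faithful if `L_x = L_y` implies `x = y`,
where `L_x` is the left multiplication `y ↦ x ◃ y`. -/
def IsFaithfulRack (R : Type*) [Rack R] : Prop :=
  ∀ x y : R, Rack.act' x = Rack.act' y → x = y

/-- A rack is superfaithful if all of its subalgebras are faithful. -/
def IsSuperfaithful (R : Type*) [Rack R] : Prop :=
  ∀ S : Subrack R, IsFaithfulRack S.carrier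

/-- The subgroup `Fix(θ)` of the elements fixed by an automorphism `θ`. -/
def fixSubgroup {G : Type*} [Group G] (θ : MulAut G) : Subgroup G where
  carrier := {x | θ x = x}
  one_mem' := map_one θ
  mul_mem' {x y} hx hy := by
    simp only [Set.mem_ofPred_eq] at hx hy ⊢
    rw [map_mul, hx, hy]
  inv_mem' {x} hx := by
    simp only [Set.mem_ofPred_eq] at hx ⊢
    rw [map_inv, hx]

/-- The underlying set `G / H` (left cosets) of the coset quandle `Q(G, H, θ)`, for `H ≤ Fix(θ)`. -/
def CosetQuandle {G : Type*} [Group G] (H : Subgroup G) (θ : MulAut G)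
    (_hH : H ≤ fixSubgroup θ) : Type _ :=
  G ⧸ H

namespace CosetQuandle

/-- For `φ ∈ Aut(G)` fixing `H` pointwise, the operation `(xH, yH) ↦ x φ(x⁻¹ y) H` on `G / H`. -/
def op {G : Type*} [Group G] (H : Subgroup G) (φ : MulAut G) (hH : H ≤ fixSubgroup φ) :
    G ⧸ H → G ⧸ H → G ⧸ H :=
  Quotient.map₂ (fun x y => x * φ (x⁻¹ * y)) (by
    intro x x' hx y y' hy
    rw [← Quotient.eq_iff_equiv] at hx hy ⊢
    have hx' : x⁻¹ * x' ∈ H := QuotientGroup.eq.mp hx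
    have hy' : y⁻¹ * y' ∈ H := QuotientGroup.eq.mp hy
    refine QuotientGroup.eq.mpr ?_
    have fx : φ (x⁻¹ * x') = x⁻¹ * x' := hH hx'
    have fy : φ (y⁻¹ * y') = y⁻¹ * y' := hH hy'
    have key : (x * φ (x⁻¹ * y))⁻¹ * (x' * φ (x'⁻¹ * y')) = y⁻¹ * y' := by
      have e : (x * φ (x⁻¹ * y))⁻¹ * (x' * φ (x'⁻¹ * y')) =
          (φ (x⁻¹ * y))⁻¹ * (x⁻¹ * x') * φ (x'⁻¹ * y') := by group
      rw [e, ← fx, ← fy]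
      simp only [map_mul, map_inv]
      group
    rw [key]
    exact hy')

/-- If `H ≤ Fix(θ)` then `H ≤ Fix(θ⁻¹)`. -/
theorem le_fix_inv {G : Type*} [Group G] {H : Subgroup G} {θ : MulAut G}
    (hH : H ≤ fixSubgroup θ) : H ≤ fixSubgroup θ⁻¹ := by
  intro h hh
  have e : θ h = h := hH hh
  change θ.symm h = h
  rw [MulEquiv.symm_apply_eq, e]

/-- The coset quandle `Q(G, H, θ)`, with `xH * yH = x θ(x⁻¹ y) H`. -/
instance instQuandle {G : Type*} [Group G] (H : Subgroup G) (θ : MulAut G)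
    (hH : H ≤ fixSubgroup θ) : Quandle (CosetQuandle H θ hH) where
  act := op H θ hH
  invAct := op H θ⁻¹ (le_fix_inv hH)
  self_distrib {a b c} := by
    induction a using Quotient.inductionOn
    induction b using Quotient.inductionOn
    induction c using Quotient.inductionOn
    refine congrArg (Quotient.mk _) ?_
    simp only [map_mul, map_inv]
    group
  left_inv a b := by
    induction a using Quotient.inductionOn
    induction b using Quotient.inductionOn
    refine congrArg (Quotient.mk _) ?_
    simp
  right_inv a b := by
    induction a using Quotient.inductionOn
    induction b using Quotient.inductionOn
    refine congrArg (Quotient.mk _) ?_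
    simp
  fix {a} := by
    induction a using Quotient.inductionOn
    refine congrArg (Quotient.mk _) ?_
    simp

end CosetQuandle

/-- The automorphism `θ_t` of `G^t`,
`θ_t (x_1, …, x_t) = (θ(x_t), x_1, …, x_{t-1})` (coordinates are indexed from `0` here). -/
def shiftAut {G : Type*} [Group G] (t : ℕ) (θ : MulAut G) : MulAut (Fin t → G) where
  toFun x i := if i.val = 0 then θ (x ⟨t - 1, Nat.sub_one_lt_of_lt i.isLt⟩) else x ⟨i.val - 1, by omega⟩
  invFun x i := if h : i.val + 1 < t then x ⟨i.val + 1, h⟩ else θ.symm (x ⟨0, i.pos⟩)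
  left_inv x := by
    funext i
    by_cases h : i.val + 1 < t
    · simp [h]
    · have e : (⟨t - 1, by omega⟩ : Fin t) = i := Fin.ext (by simp; omega)
      simp [h, e]
  right_inv x := by
    funext i
    by_cases h : i.val = 0
    · have e : (⟨0, by omega⟩ : Fin t) = i := Fin.ext (by simp [h])
      have h' : ¬ (t - 1 + 1 < t) := by omega
      simp [h, e, h']
    · have h' : i.val - 1 + 1 < t := by omega
      have e : (⟨i.val - 1 + 1, h'⟩ : Fin t) = i := Fin.ext (by simp; omega)
      simp [h, e, h']
  map_mul' x y := by
    funext i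
    by_cases h : i.val = 0 <;> simp [h]

/-- The quandle `(G, t, θ) = Q(G^t, Fix(θ_t), θ_t)`. -/
abbrev PowerQuandle (G : Type*) [Group G] (t : ℕ) (θ : MulAut G) : Type _ :=
  CosetQuandle (fixSubgroup (shiftAut t θ)) (shiftAut t θ) le_rfl

/-! A quandle fails to be superfaithful exactly when it has distinct `a`, `b` with `a * b = b` and
`b * a = a`. For the coset quandle of `φ` this means that `φ` fixes a coset of `Fix φ` other than
the trivial one. For `φ = θ_t`, solving `x θ_t(x)⁻¹ ∈ Fix θ_t` coordinatewise leads to `x_i = a ^ i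
y` with `θ a = a` and `a ^ t = y θ(y)⁻¹`, so only `a = 1` may be possible. Hence `θ` inherits the
condition, and if `θ = 1` there must be no `t`-torsion, which by Cauchy's theorem means `gcd(t, n!)
= 1`. It remains to show `θ = 1`. If `θ` is conjugation by `s ≠ 1`, some `y ∈ A_n` makes `y s y⁻¹`
commute with `s` and differ from it (`exists_mem_alternatingGroup_commute_conj`); then `y`
represents a second fixed coset. Counting elements of order 3 shows that `θ` preserves 3-cycles,
hence is such a conjugation, unless `n = 6` and `θ` is exotic. An exotic `θ` would have 2-power
order, so its fixed subgroup would contain a conjugate of every 2-subgroup; a Klein four-group then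
gives a contradiction. -/

/-! ### Superfaithfulness and fixed cosets -/

/-- `1 · Fix θ` is the only left coset of `Fix θ` that `θ` maps to itself. -/
def HasUniqueFixedCoset {G : Type*} [Group G] (θ : MulAut G) : Prop :=
  ∀ z : G, z⁻¹ * θ z ∈ fixSubgroup θ → z ∈ fixSubgroup θ

theorem mem_fixSubgroup {G : Type*} [Group G] {θ : MulAut G} {x : G} :
    x ∈ fixSubgroup θ ↔ θ x = x := Iff.rfl

/-- Both sides amount to `θ (θ z) = θ z * z⁻¹ * θ z`. -/
theorem inv_mul_map_mem_fixSubgroup_iff {G : Type*} [Group G] {θ : MulAut G} {z : G} :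
    z⁻¹ * θ z ∈ fixSubgroup θ ↔ z * (θ z)⁻¹ ∈ fixSubgroup θ := by
  simp only [mem_fixSubgroup, map_mul, map_inv]
  constructor <;> intro h
  · have h1 : θ (θ z) = θ z * z⁻¹ * θ z := by
      rw [mul_assoc, ← h]; group
    rw [h1]; group
  · have h1 : θ (θ z) = θ z * z⁻¹ * θ z := by
      have h2 : (θ (θ z))⁻¹ = (θ z)⁻¹ * (z * (θ z)⁻¹) := by rw [← h]; group
      rw [← inv_inv (θ (θ z)), h2]; group
    rw [h1]; group

/-- The coset `xH` as an element of the coset quandle. -/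
def CosetQuandle.mk {G : Type*} [Group G] (H : Subgroup G) (φ : MulAut G)
    (hH : H ≤ fixSubgroup φ) (x : G) : CosetQuandle H φ hH :=
  (x : G ⧸ H)

namespace CosetQuandle

variable {G : Type*} [Group G] {H : Subgroup G} {φ : MulAut G} {hH : H ≤ fixSubgroup φ}

theorem mk_act_mk (x y : G) : mk H φ hH x ◃ mk H φ hH y = mk H φ hH (x * φ (x⁻¹ * y)) := rfl

theorem mk_eq_mk {x y : G} : mk H φ hH x = mk H φ hH y ↔ x⁻¹ * y ∈ H := QuotientGroup.eq

theorem mk_surjective (a : CosetQuandle H φ hH) : ∃ x, a = mk H φ hH x :=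
  ⟨_, (QuotientGroup.out_eq' a).symm⟩

end CosetQuandle

/-- In a quandle, two elements fixing each other form a subalgebra. -/
def Subrack.pair {R : Type*} [Quandle R] (a b : R) (hab : a ◃ b = b) (hba : b ◃ a = a) :
    Subrack R where
  carrier := {a, b}
  act_mem {x y} hx hy := by
    rcases hx with rfl | rfl <;> rcases hy with rfl | rfl <;> simp_all
  invAct_mem {x y} hx hy := by
    have hab' : a ◃⁻¹ b = b := by rw [← Rack.left_cancel a, Rack.right_inv, hab]
    have hba' : b ◃⁻¹ a = a := by rw [← Rack.left_cancel b, Rack.right_inv, hba]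
    rcases hx with rfl | rfl <;> rcases hy with rfl | rfl <;> simp_all

/-- If `L_a = L_b` on a subalgebra, idempotence gives `a * b = b * b = b` and likewise `b * a = a`.
Conversely, such a pair is itself a subalgebra on which both translations are the identity. -/
theorem isSuperfaithful_iff_of_quandle {R : Type*} [Quandle R] :
    IsSuperfaithful R ↔ ∀ a b : R, a ◃ b = b → b ◃ a = a → a = b := by
  constructor
  · intro h a b hab hba
    have := h (Subrack.pair a b hab hba) ⟨a, Or.inl rfl⟩ ⟨b, Or.inr rfl⟩ (by
      ext ⟨x, hx⟩
      have : a ◃ x = b ◃ x := by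
        rcases hx with rfl | rfl
        · rw [hba, Quandle.fix]
        · rw [hab, Quandle.fix]
      exact this)
    exact congrArg Subtype.val this
  · intro h S a b hab
    have key : ∀ x : S.carrier, a.1 ◃ x.1 = b.1 ◃ x.1 := fun x =>
      congrArg Subtype.val (DFunLike.congr_fun hab x)
    refine Subtype.ext (h _ _ ?_ ?_)
    · rw [key b, Quandle.fix]
    · rw [← key a, Quandle.fix]

theorem isSuperfaithful_cosetQuandle_iff {G : Type*} [Group G] (φ : MulAut G) :
    IsSuperfaithful (CosetQuandle (fixSubgroup φ) φ le_rfl) ↔ HasUniqueFixedCoset φ := by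
  rw [isSuperfaithful_iff_of_quandle]
  constructor
  · intro h z hz
    have := h (.mk _ φ le_rfl 1) (.mk _ φ le_rfl z)
      (by
        rw [CosetQuandle.mk_act_mk, eq_comm, CosetQuandle.mk_eq_mk]
        simpa using hz)
      (by
        rw [CosetQuandle.mk_act_mk, CosetQuandle.mk_eq_mk]
        simpa using (fixSubgroup φ).inv_mem (inv_mul_map_mem_fixSubgroup_iff.1 hz))
    simpa using CosetQuandle.mk_eq_mk.1 this
  · intro h a b hab _
    obtain ⟨x, rfl⟩ := CosetQuandle.mk_surjective a
    obtain ⟨y, rfl⟩ := CosetQuandle.mk_surjective b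
    rw [CosetQuandle.mk_eq_mk]
    rw [CosetQuandle.mk_act_mk, eq_comm, CosetQuandle.mk_eq_mk] at hab
    refine h _ ?_
    rwa [mul_inv_rev, inv_inv, mul_assoc]

/-! ### Fixed cosets of the shift automorphism -/

section Power

variable {G : Type*} [Group G] {t : ℕ} {θ : MulAut G}

theorem shiftAut_apply_zero (x : Fin t → G) (h : 0 < t) :
    shiftAut t θ x ⟨0, h⟩ = θ (x ⟨t - 1, by omega⟩) := rfl

theorem shiftAut_apply_succ (x : Fin t → G) (i : ℕ) (h : i + 1 < t) :
    shiftAut t θ x ⟨i + 1, h⟩ = x ⟨i, by omega⟩ := rfl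

/-- For `x_i = a ^ i y` the quotient `x θ_t(x)⁻¹` is constantly `a`; the condition on `a ^ t` is
what makes coordinate `0` agree. -/
theorem eq_one_of_hasUniqueFixedCoset_shiftAut (ht : 1 ≤ t)
    (h : HasUniqueFixedCoset (shiftAut t θ)) {a y : G} (ha : θ a = a)
    (hy : a ^ t = y * (θ y)⁻¹) : a = 1 := by
  obtain ⟨t, rfl⟩ : ∃ s, t = s + 1 := ⟨t - 1, by omega⟩
  set x : Fin (t + 1) → G := fun i => a ^ i.val * y with hx
  have hsh : x * (shiftAut (t + 1) θ x)⁻¹ = fun _ => a := by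
    funext ⟨i, hi⟩
    rw [Pi.mul_apply, Pi.inv_apply]
    cases i with
    | zero =>
      rw [shiftAut_apply_zero]
      simp only [hx, map_mul, map_pow, ha, mul_inv_rev, pow_zero, one_mul, ← mul_assoc, ← hy]
      simp [pow_succ']
    | succ i =>
      rw [shiftAut_apply_succ]
      simp [hx, pow_succ']
  have hfix : x ∈ fixSubgroup (shiftAut (t + 1) θ) := by
    refine h x (inv_mul_map_mem_fixSubgroup_iff.2 ?_)
    rw [hsh, mem_fixSubgroup]
    funext ⟨i, hi⟩
    cases i with
    | zero => rw [shiftAut_apply_zero, ha]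
    | succ i => rw [shiftAut_apply_succ]
  rw [mem_fixSubgroup.1 hfix, mul_inv_cancel] at hsh
  exact (congrFun hsh ⟨0, by omega⟩).symm

/-- Put `u = z θ(z)⁻¹ ∈ Fix θ`. The previous lemma with `y = 1` forces the order of `u` to be
coprime to `t`. So `u = (u ^ m) ^ t` for some `m`, and the lemma with `y = z` gives `u ^ m = 1`. -/
theorem hasUniqueFixedCoset_of_shiftAut [Finite G] (ht : 1 ≤ t)
    (h : HasUniqueFixedCoset (shiftAut t θ)) : HasUniqueFixedCoset θ := by
  intro z hz
  rw [inv_mul_map_mem_fixSubgroup_iff] at hz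
  set u := z * (θ z)⁻¹ with hu
  suffices hu1 : u = 1 by
    rw [hu, mul_inv_eq_one] at hu1
    exact hu1.symm
  have hpow : ∀ k : ℕ, θ (u ^ k) = u ^ k := fun k => by rw [map_pow, mem_fixSubgroup.1 hz]
  have hco : (orderOf u).Coprime t := by
    have h1 : u ^ (orderOf u / (orderOf u).gcd t) = 1 := by
      refine eq_one_of_hasUniqueFixedCoset_shiftAut ht h (y := 1) (hpow _) ?_
      rw [map_one, inv_one, mul_one, ← pow_mul, ← orderOf_dvd_iff_pow_eq_one,
        ← Nat.mul_div_right_comm (Nat.gcd_dvd_left _ _), Nat.mul_div_assoc _ (Nat.gcd_dvd_right _ _)]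
      exact Nat.dvd_mul_right _ _
    have h2 := Nat.le_of_dvd (Nat.div_pos (Nat.gcd_le_left _ (orderOf_pos u))
      (Nat.gcd_pos_of_pos_left _ (orderOf_pos u))) (orderOf_dvd_of_pow_eq_one h1)
    by_contra hne
    refine absurd h2 (not_le.2 (Nat.div_lt_self (orderOf_pos u) ?_))
    have := Nat.gcd_pos_of_pos_left t (orderOf_pos u)
    have hne' : (orderOf u).gcd t ≠ 1 := hne
    omega
  obtain ⟨m, hm⟩ := exists_pow_eq_self_of_coprime hco.symm
  have h1 : u ^ m = 1 := by
    refine eq_one_of_hasUniqueFixedCoset_shiftAut ht h (y := z) (hpow _) ?_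
    rw [← hu, ← pow_mul, mul_comm, pow_mul, hm]
  rw [← hm, ← pow_mul, mul_comm, pow_mul, h1, one_pow]

/-- A fixed point of the shift is a constant `a`, so `x_i = a ^ i x_0`, and going once around the
cycle gives `a ^ t = 1`. -/
theorem hasUniqueFixedCoset_shiftAut_one (ht : 1 ≤ t) (h : ∀ a : G, a ^ t = 1 → a = 1) :
    HasUniqueFixedCoset (shiftAut t (1 : MulAut G)) := by
  intro x hx
  obtain ⟨t, rfl⟩ : ∃ s, t = s + 1 := ⟨t - 1, by omega⟩
  rw [inv_mul_map_mem_fixSubgroup_iff] at hx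
  set u := x * (shiftAut (t + 1) 1 x)⁻¹ with hu
  have hconst : ∀ i (hi : i < t + 1), u ⟨i, hi⟩ = u ⟨0, by omega⟩ := by
    intro i
    induction i with
    | zero => intro _; rfl
    | succ i ih =>
      intro hi
      rw [← ih (by omega), ← shiftAut_apply_succ (θ := 1) u i hi, mem_fixSubgroup.1 hx]
  set a := u ⟨0, by omega⟩ with ha
  have hxi : ∀ i (hi : i < t + 1), x ⟨i, hi⟩ = a ^ i * x ⟨0, by omega⟩ := by
    intro i
    induction i with
    | zero => intro _; simp
    | succ i ih =>
      intro hi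
      have h1 : u ⟨i + 1, hi⟩ = x ⟨i + 1, hi⟩ * (x ⟨i, by omega⟩)⁻¹ := rfl
      rw [hconst, eq_mul_inv_iff_mul_eq, ih (by omega), ← mul_assoc, ← pow_succ'] at h1
      exact h1.symm
  have h0 : a = x ⟨0, by omega⟩ * (x ⟨t, by omega⟩)⁻¹ := rfl
  have ha1 : a = 1 := by
    apply h
    rw [hxi t (by omega), mul_inv_rev, ← mul_assoc, mul_inv_cancel, one_mul,
      eq_inv_iff_mul_eq_one, ← pow_succ'] at h0
    exact h0
  have hu1 : u = 1 := by
    funext ⟨i, hi⟩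
    rw [hconst, ← ha, ha1, Pi.one_apply]
  rw [hu, mul_inv_eq_one] at hu1
  exact hu1.symm

end Power

/-! ### Conjugacy under the alternating group -/

theorem odd_multiset_lcm {m : Multiset ℕ} (h : ∀ c ∈ m, Odd c) : Odd m.lcm := by
  induction m using Multiset.induction_on with
  | empty => simp
  | cons a m ih =>
    rw [Multiset.lcm_cons]
    refine Odd.of_dvd_nat ((h a (Multiset.mem_cons_self a m)).mul
      (ih fun c hc => h c (Multiset.mem_cons_of_mem hc))) (lcm_dvd_mul _ _)

namespace Equiv.Perm

variable {α : Type*} [Fintype α] [DecidableEq α]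

theorem cycleType_pow_of_coprime {σ : Perm α} {k : ℕ} (h : k.Coprime (orderOf σ)) :
    (σ ^ k).cycleType = σ.cycleType := by
  induction σ using cycle_induction_on with
  | base_one => simp
  | base_cycles σ hσ =>
    rw [hσ.cycleType, ((hσ.pow_iff).2 h).cycleType, support_pow_coprime h]
  | induction_disjoint σ τ hd _ hσ hτ =>
    rw [hd.orderOf] at h
    have h1 := hσ (h.coprime_dvd_right (Nat.dvd_lcm_left _ _))
    have h2 := hτ (h.coprime_dvd_right (Nat.dvd_lcm_right _ _))
    rw [hd.commute.mul_pow, (hd.pow_disjoint_pow k k).cycleType_mul, h1, h2, hd.cycleType_mul]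

/-- An odd element centralizing `s` corrects the parity of a conjugating permutation. -/
theorem exists_mem_alternatingGroup_conj_eq {s s' : Perm α}
    (h : ¬ Subgroup.centralizer {s} ≤ alternatingGroup α) (hc : IsConj s s') :
    ∃ y ∈ alternatingGroup α, y * s * y⁻¹ = s' := by
  obtain ⟨c, hcs, hodd⟩ := SetLike.not_le_iff_exists.1 h
  rw [Subgroup.mem_centralizer_singleton_iff] at hcs
  obtain ⟨z, hz⟩ := isConj_iff.1 hc
  rw [mem_alternatingGroup] at hodd
  by_cases hz1 : sign z = 1
  · exact ⟨z, hz1, hz⟩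
  · refine ⟨z * c, ?_, ?_⟩
    · rw [mem_alternatingGroup, sign_mul, (Int.units_eq_one_or _).resolve_left hz1,
        (Int.units_eq_one_or _).resolve_left hodd]
      rfl
    · rw [mul_assoc z, hcs, ← hz]; group

/-- If `z` conjugates `s` to `s ^ 2`, then `z ^ 2`, which is even, conjugates `s` to `s ^ 4`. -/
theorem exists_mem_alternatingGroup_conj_eq_pow_four {s : Perm α}
    (h : Nat.Coprime 2 (orderOf s)) : ∃ y ∈ alternatingGroup α, y * s * y⁻¹ = s ^ 4 := by
  obtain ⟨z, hz⟩ := isConj_iff.1 (isConj_of_cycleType_eq (cycleType_pow_of_coprime h).symm)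
  refine ⟨z ^ 2, by simp [mem_alternatingGroup], ?_⟩
  calc z ^ 2 * s * (z ^ 2)⁻¹ = z * (z * s * z⁻¹) * z⁻¹ := by
        rw [sq, mul_inv_rev]; simp only [mul_assoc]
    _ = s ^ 4 := by rw [hz, ← conj_pow, hz, ← pow_mul]

/-- Either two cycles have the same length or two points are fixed; a centralizer of even
permutations allows neither. -/
theorem not_centralizer_le_of_replicate {s : Perm α} {k m : ℕ}
    (hα : k + 2 ≤ Fintype.card α) (h : s.cycleType = Multiset.replicate m k) :
    ¬ Subgroup.centralizer {s} ≤ alternatingGroup α := fun hle => by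
  obtain ⟨_, h1, h2⟩ := centralizer_le_alternating_iff.1 hle
  have h2 := h2 k
  rw [h, Multiset.count_replicate_self] at h2
  rw [h, Multiset.sum_replicate, smul_eq_mul] at h1
  have : m * k ≤ 1 * k := Nat.mul_le_mul_right k h2
  omega

theorem exists_isConj_commute_of_sq_eq_one {s : Perm α} (hα : 4 ≤ Fintype.card α)
    (hs : s ≠ 1) (h2 : s ^ 2 = 1) : ∃ s', IsConj s s' ∧ s' ≠ s ∧ Commute s s' := by
  have hss : ∀ v, s (s v) = v := fun v => by rw [← mul_apply, ← sq, h2, one_apply]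
  obtain ⟨x, hx⟩ : ∃ x, s x ≠ x := by
    by_contra! h
    exact hs (ext h)
  by_cases hz : ∃ z, z ≠ x ∧ z ≠ s x ∧ s z ≠ z
  · obtain ⟨z, hzx, hzy, hz⟩ := hz
    -- This re-pairs the points: `(x y)(z w)` becomes `(x z)(y w)`. In the other case `s` is a
    -- transposition and a disjoint one is taken.
    refine ⟨swap (s x) z * s * (swap (s x) z)⁻¹, isConj_iff.2 ⟨_, rfl⟩, fun h => ?_, ?_⟩
    · have := DFunLike.congr_fun h x
      simp only [swap_inv, mul_apply] at this
      grind
    · ext v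
      have h1 := hss v
      have h2 := hss x
      have h3 := hss z
      simp only [swap_inv, mul_apply]
      grind
  · push Not at hz
    have hsx : s = swap x (s x) := by
      ext v
      have h2 := hss x
      have := hz v
      grind
    obtain ⟨u, -, hu⟩ := Finset.exists_mem_notMem_of_card_lt_card
      (s := {x, s x}) (t := Finset.univ) (by
        rw [Finset.card_univ]
        exact lt_of_le_of_lt Finset.card_le_two (by omega))
    obtain ⟨v, -, hv⟩ := Finset.exists_mem_notMem_of_card_lt_card
      (s := {x, s x, u}) (t := Finset.univ) (by
        rw [Finset.card_univ]
        exact lt_of_le_of_lt Finset.card_le_three (by omega))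
    simp only [Finset.mem_insert, Finset.mem_singleton, not_or] at hu hv
    refine ⟨swap u v, ?_, fun h => ?_, ?_⟩
    · rw [hsx]
      exact isConj_swap (Ne.symm hx) (Ne.symm hv.2.2)
    · have := DFunLike.congr_fun h u
      rw [swap_apply_left, hz u hu.1 hu.2] at this
      exact hv.2.2 this
    · rw [hsx]
      refine (disjoint_swap_swap ?_).commute
      simp only [List.nodup_cons, List.mem_cons, List.not_mem_nil]
      grind

/-- A nontrivial permutation of at least six points commutes with some other permutation that is
conjugate to it under the alternating group. -/
theorem exists_mem_alternatingGroup_commute_conj {s : Perm α} (hα : 5 < Fintype.card α)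
    (hs : s ≠ 1) :
    ∃ y ∈ alternatingGroup α, y * s * y⁻¹ ≠ s ∧ Commute s (y * s * y⁻¹) := by
  -- If the centralizer is even, `s` has odd order and `s ^ 4` serves, as `s ^ 3 = 1` would give
  -- equal cycles or two fixed points. Otherwise any conjugate in `S_n` will do: `s⁻¹`, or another
  -- involution when `s ^ 2 = 1`.
  by_cases hle : Subgroup.centralizer {s} ≤ alternatingGroup α
  · have hodd := (centralizer_le_alternating_iff.1 hle).1
    have hco : Nat.Coprime 2 (orderOf s) := by
      rw [Nat.coprime_two_left, ← lcm_cycleType]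
      exact odd_multiset_lcm hodd
    have h3 : s ^ 3 ≠ 1 := fun h3 => by
      have : Fact (Nat.Prime 3) := ⟨Nat.prime_three⟩
      exact not_centralizer_le_of_replicate (by omega) (cycleType_of_pow_prime_eq_one h3) hle
    obtain ⟨y, hy, hys⟩ := exists_mem_alternatingGroup_conj_eq_pow_four hco
    refine ⟨y, hy, ?_, ?_⟩
    · rw [hys]
      intro h
      exact h3 (mul_right_cancel (b := s) (by rw [one_mul, ← pow_succ, h]))
    · rw [hys]
      exact (Commute.refl s).pow_right 4
  · by_cases h2 : s ^ 2 = 1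
    · obtain ⟨s', hc, hne, hcom⟩ := exists_isConj_commute_of_sq_eq_one (by omega) hs h2
      obtain ⟨y, hy, rfl⟩ := exists_mem_alternatingGroup_conj_eq hle hc
      exact ⟨y, hy, hne, hcom⟩
    · obtain ⟨y, hy, hys⟩ := exists_mem_alternatingGroup_conj_eq hle
        (isConj_of_cycleType_eq (cycleType_inv s).symm)
      refine ⟨y, hy, ?_, ?_⟩
      · rw [hys]
        intro h
        apply h2
        rw [sq]
        nth_rw 1 [← h]
        exact inv_mul_cancel s
      · rw [hys]
        exact (Commute.refl s).inv_right

end Equiv.Perm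

/-! ### Arrows of 3-cycles -/

namespace Equiv.Perm

/-- The permutation that maps `a ↦ b ↦ c ↦ a`, for distinct `a`, `b` and `c`. -/
def cyc {α : Type*} [DecidableEq α] (a b c : α) : Perm α := swap a b * swap b c

section cyc

variable {α : Type*} [DecidableEq α] {a b c d : α}

theorem cyc_apply_left (hab : a ≠ b) (hac : a ≠ c) : cyc a b c a = b := by
  grind [cyc, mul_apply]

theorem cyc_apply_middle (hac : a ≠ c) (hbc : b ≠ c) : cyc a b c b = c := by
  grind [cyc, mul_apply]

theorem cyc_rotate (hab : a ≠ b) (hac : a ≠ c) (hbc : b ≠ c) : cyc a b c = cyc b c a := by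
  ext v
  grind [cyc, mul_apply]

theorem cyc_inv (hab : a ≠ b) (hac : a ≠ c) (hbc : b ≠ c) : (cyc a b c)⁻¹ = cyc a c b := by
  rw [inv_eq_iff_mul_eq_one]
  ext v
  grind [cyc, mul_apply, one_apply]

/-- This relation survives any automorphism, and `IsThreeCycle.exists_apply_eq` recovers a common
arrow from it. -/
theorem cyc_mul_cyc_mul_self (hab : a ≠ b) (hac : a ≠ c) (had : a ≠ d) (hbc : b ≠ c)
    (hbd : b ≠ d) (hcd : c ≠ d) : cyc a b c * cyc a b d * (cyc a b c * cyc a b d) = 1 := by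
  have h : cyc a b c * cyc a b d = swap a c * swap b d := by
    ext v
    grind [cyc, mul_apply]
  rw [h]
  ext v
  grind [mul_apply, one_apply]

theorem cyc_mul_cyc_inv (hab : a ≠ b) (hac : a ≠ c) (had : a ≠ d) (hbc : b ≠ c) (hbd : b ≠ d)
    (hcd : c ≠ d) : cyc a b c * (cyc a b d)⁻¹ = cyc a d c := by
  rw [cyc_inv hab had hbd]
  ext v
  grind [cyc, mul_apply]

end cyc

variable {α : Type*} [Fintype α] [DecidableEq α]

theorem IsThreeCycle.apply_apply_apply {c : Perm α} (hc : c.IsThreeCycle) (x : α) :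
    c (c (c x)) = x := by
  have h : c ^ 3 = 1 := by rw [← hc.orderOf, pow_orderOf_eq_one]
  have := DFunLike.congr_fun h x
  simpa [pow_succ] using this

theorem IsThreeCycle.apply_eq_self {c : Perm α} (hc : c.IsThreeCycle) {x v : α} (hx : c x ≠ x)
    (h0 : v ≠ x) (h1 : v ≠ c x) (h2 : v ≠ c (c x)) : c v = v := by
  by_contra h
  have := (hc.support_eq_iff_mem_support (a := x)).2 (mem_support.2 hx)
  have hv := mem_support.2 h
  rw [this] at hv
  simp_all

theorem IsThreeCycle.eq_of_apply_eq {c d : Perm α} (hc : c.IsThreeCycle) (hd : d.IsThreeCycle)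
    {x : α} (hx : c x ≠ x) (h1 : c x = d x) (h2 : c (c x) = d (d x)) : c = d := by
  rw [(hc.eq_swap_mul_swap_iff_mem_support (a := x)).2 (mem_support.2 hx),
    (hd.eq_swap_mul_swap_iff_mem_support (a := x)).2 (mem_support.2 (h1 ▸ hx)), h2, h1]

/-- Two 3-cycles whose product is an involution agree at a point that they both move. -/
theorem IsThreeCycle.exists_apply_eq {c d : Perm α} (hc : c.IsThreeCycle) (hd : d.IsThreeCycle)
    (hcd : ∀ x, c (d (c (d x))) = x) (hne : c * d ≠ 1) :
    ∃ x, c x = d x ∧ c x ≠ x := by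
  have c3 := hc.apply_apply_apply
  have d3 := hd.apply_apply_apply
  by_cases hp : ∃ p, c p = p ∧ d p ≠ p
  · obtain ⟨p, hcp, hdp⟩ := hp
    have h1 := hcd p
    grind only
  · push Not at hp
    obtain ⟨x, hx⟩ : ∃ x, d x ≠ x := by
      by_contra! h
      exact hd.ne_one (ext h)
    have h1 : c x ≠ x := fun h => hx (hp x h)
    have h2 : c (d x) ≠ d x := fun h => by
      have := hp _ h
      grind only
    have h3 := fun v => hc.apply_eq_self (v := v) h1
    by_cases h : c x = d x
    · exact ⟨x, h, h1⟩
    · have h4 : d x = c (c x) := by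
        by_contra h'
        exact h2 (h3 _ hx (Ne.symm h) h')
      have h5 : d (d x) = c x := by
        have h6 : c (d (d x)) ≠ d (d x) := fun h' => hx (d.injective (d.injective (hp _ h')))
        have h7 : d (d x) ≠ x := fun h' => hx ((congrArg d h').symm.trans (d3 x))
        by_contra h8
        exact h6 (h3 _ h7 h8 fun h' => hx (d.injective (h'.trans h4.symm)))
      -- The supports coincide and the orientations are opposite, so `d = c⁻¹`.
      refine absurd ?_ hne
      rw [mul_eq_one_iff_inv_eq, eq_comm]
      refine hd.eq_of_apply_eq hc.inv hx ?_ ?_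
      · rw [h4, eq_inv_iff_eq, c3]
      · rw [h5, eq_inv_iff_eq, eq_inv_iff_eq, c3]

/-- Let `c` and `d` be `(x b p)` and `(x b q)` with `p ≠ q`. If `e` took its arrows from `c` and `d`
away from `x ↦ b`, it would move four points or fail to be a bijective map. -/
theorem IsThreeCycle.apply_eq_of_pairwise {c d e : Perm α} (hc : c.IsThreeCycle)
    (hd : d.IsThreeCycle) (he : e.IsThreeCycle) {x : α} (hx : c x ≠ x) (hxd : c x = d x)
    (hcd : c ≠ d) (hce : c ≠ e) (hde : d ≠ e)
    (h1 : ∃ x, c x = e x ∧ c x ≠ x) (h2 : ∃ x, d x = e x ∧ d x ≠ x) : e x = c x := by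
  obtain ⟨y, hy, hy'⟩ := h1
  obtain ⟨z, hz, hz'⟩ := h2
  have c3 := hc.apply_apply_apply
  have d3 := hd.apply_apply_apply
  have e3 := he.apply_apply_apply
  have k1 : c (c x) ≠ d (d x) := fun h => hcd (hc.eq_of_apply_eq hd hx hxd h)
  have k2 : c (c y) ≠ e (e y) := fun h => hce (hc.eq_of_apply_eq he hy' hy h)
  have k3 : d (d z) ≠ e (e z) := fun h => hde (hd.eq_of_apply_eq he hz' hz h)
  have c4 := fun v => hc.apply_eq_self (v := v) hx
  have d4 := fun v => hd.apply_eq_self (v := v) (x := x) (hxd ▸ hx)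
  have e4 := fun v => he.apply_eq_self (v := v) (x := y) (hy ▸ hy')
  have hyc : y = x ∨ y = c x ∨ y = c (c x) := by
    by_contra! h
    exact hy' (c4 y h.1 h.2.1 h.2.2)
  have hzc : z = x ∨ z = d x ∨ z = d (d x) := by
    by_contra! h
    exact hz' (d4 z h.1 h.2.1 h.2.2)
  have hze : z = y ∨ z = e y ∨ z = e (e y) := by
    by_contra! h
    exact (hz ▸ hz') (e4 z h.1 h.2.1 h.2.2)
  clear c4 d4 e4
  grind only

theorem isThreeCycle_cyc {a b c : α} (hab : a ≠ b) (hac : a ≠ c) (hbc : b ≠ c) : (cyc a b c).IsThreeCycle := by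
  rw [cyc, swap_comm a b]
  exact isThreeCycle_swap_mul_swap_same hab.symm hbc hac

theorem IsThreeCycle.eq_cyc {g : Perm α} (hg : g.IsThreeCycle) {x : α} (hx : g x ≠ x) :
    g = cyc x (g x) (g (g x)) :=
  (hg.eq_swap_mul_swap_iff_mem_support).2 (mem_support.2 hx)

/-- The 3-cycles that contain a fixed arrow generate the alternating group. -/
theorem alternatingGroup_le_of_cyc_mem {H : Subgroup (Perm α)} {p q : α} (hpq : p ≠ q)
    (h : ∀ i, i ≠ p → i ≠ q → cyc p q i ∈ H) : alternatingGroup α ≤ H := by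
  have h1 : ∀ i j, i ≠ p → j ≠ p → i ≠ j → cyc p i j ∈ H := by
    intro i j hi hj hij
    by_cases hiq : i = q
    · subst hiq
      exact h j hj (Ne.symm hij)
    by_cases hjq : j = q
    · subst hjq
      rw [← cyc_inv hj.symm hi.symm hij.symm]
      exact H.inv_mem (h i hi hiq)
    · rw [← cyc_mul_cyc_inv hpq hj.symm hi.symm (Ne.symm hjq) (Ne.symm hiq) hij.symm]
      exact H.mul_mem (h j hj hjq) (H.inv_mem (h i hi hiq))
  have h2 : ∀ i j k, i ≠ j → i ≠ k → j ≠ k → cyc i j k ∈ H := by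
    intro i j k hij hik hjk
    by_cases hip : i = p
    · subst hip
      exact h1 j k hij.symm hik.symm hjk
    by_cases hjp : j = p
    · subst hjp
      rw [cyc_rotate hij hik hjk]
      exact h1 k i hjk.symm hij hik.symm
    by_cases hkp : k = p
    · subst hkp
      rw [cyc_rotate hij hik hjk, cyc_rotate hjk hij.symm hik.symm]
      exact h1 i j hik hjk hij
    · rw [← cyc_mul_cyc_inv hip hik hij (Ne.symm hkp) (Ne.symm hjp) hjk.symm,
        cyc_rotate hip hik (Ne.symm hkp), cyc_rotate hip hij (Ne.symm hjp)]
      exact H.mul_mem (h1 k i hkp hip hik.symm) (H.inv_mem (h1 j i hjp hip hij.symm))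
  rw [← closure_three_cycles_eq_alternating, Subgroup.closure_le]
  intro g hg
  obtain ⟨x, hx⟩ : ∃ x, g x ≠ x := by
    by_contra! h
    exact IsThreeCycle.ne_one hg (ext h)
  rw [IsThreeCycle.eq_cyc hg hx]
  refine h2 _ _ _ (Ne.symm hx) (fun h => ?_) (fun h => hx (g.injective h).symm)
  have h3 := IsThreeCycle.apply_apply_apply hg x
  rw [← h] at h3
  exact hx h3

end Equiv.Perm

open Equiv Equiv.Perm

/-! ### Automorphisms preserving 3-cycles -/

section ThreeCycles

variable {α : Type*} [Fintype α] [DecidableEq α]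

/-- The 3-cycle `cyc a b c` as an element of the alternating group, when the points are distinct. -/
def altCyc (a b c : α) : alternatingGroup α :=
  if h : a ≠ b ∧ a ≠ c ∧ b ≠ c then
    ⟨cyc a b c, (isThreeCycle_cyc h.1 h.2.1 h.2.2).mem_alternatingGroup⟩
  else 1

theorem coe_altCyc {a b c : α} (hab : a ≠ b) (hac : a ≠ c) (hbc : b ≠ c) :
    (altCyc a b c : Perm α) = cyc a b c := by
  rw [altCyc, dif_pos ⟨hab, hac, hbc⟩]

/-- An automorphism of the alternating group that preserves the set of 3-cycles is the conjugation
by some permutation. -/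
theorem exists_perm_conj_of_map_isThreeCycle {θ : MulAut (alternatingGroup α)}
    (hα : 4 ≤ Fintype.card α)
    (h : ∀ g : alternatingGroup α, (g : Perm α).IsThreeCycle → (θ g : Perm α).IsThreeCycle) :
    ∃ s : Perm α, ∀ g : alternatingGroup α, (θ g : Perm α) = s * g * s⁻¹ := by
  obtain ⟨e⟩ : Nonempty (Fin 4 ↪ α) := by
    rw [Function.Embedding.nonempty_iff_card_le, Fintype.card_fin]
    exact hα
  obtain ⟨p, q, i₀, j₀, hpq, hip, hiq, hjp, hjq, hij⟩ : ∃ p q i j : α,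
      p ≠ q ∧ i ≠ p ∧ i ≠ q ∧ j ≠ p ∧ j ≠ q ∧ i ≠ j :=
    ⟨e 0, e 1, e 2, e 3, by simp, by simp, by simp, by simp, by simp, by simp⟩
  have hX : ∀ i, i ≠ p → i ≠ q → (altCyc p q i : Perm α) = cyc p q i := fun i hi hi' =>
    coe_altCyc hpq hi.symm hi'.symm
  set c : α → Perm α := fun i => (θ (altCyc p q i) : Perm α) with hc
  have hc3 : ∀ i, i ≠ p → i ≠ q → (c i).IsThreeCycle := fun i hi hi' =>
    h _ (by rw [hX i hi hi']; exact isThreeCycle_cyc hpq hi.symm hi'.symm)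
  have hcinj : ∀ i j, i ≠ p → i ≠ q → j ≠ p → j ≠ q → c i = c j → i = j := by
    intro i j hi hi' hj hj' hcc
    have h1 := congrArg Subtype.val (θ.injective (Subtype.ext hcc))
    rw [hX i hi hi', hX j hj hj'] at h1
    have h2 := DFunLike.congr_fun h1 q
    rwa [cyc_apply_middle hi.symm hi'.symm, cyc_apply_middle hj.symm hj'.symm] at h2
  have harrow : ∀ i j, i ≠ p → i ≠ q → j ≠ p → j ≠ q → i ≠ j →
      ∃ x, c i x = c j x ∧ c i x ≠ x := by
    intro i j hi hi' hj hj' hne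
    refine (hc3 i hi hi').exists_apply_eq (hc3 j hj hj') (fun x => ?_) (fun h1 => ?_)
    · have h1 : (altCyc p q i * altCyc p q j) * (altCyc p q i * altCyc p q j) = 1 := by
        refine Subtype.ext ?_
        simp only [Subgroup.coe_mul, Subgroup.coe_one, hX i hi hi', hX j hj hj']
        exact cyc_mul_cyc_mul_self hpq hi.symm hj.symm hi'.symm hj'.symm hne
      have h2 := congrArg (fun g => (θ g : Perm α) x) h1
      simpa [map_mul] using h2
    · have h2 : altCyc p q i * altCyc p q j = 1 := by
        apply θ.injective
        rw [map_mul, map_one]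
        exact Subtype.ext h1
      have h3 := congrArg (fun g : alternatingGroup α => (g : Perm α) p) h2
      simp only [Subgroup.coe_mul, Subgroup.coe_one, hX i hi hi', hX j hj hj'] at h3
      grind [cyc, Perm.mul_apply, Perm.one_apply]
  obtain ⟨a, ha, ha'⟩ := harrow i₀ j₀ hip hiq hjp hjq hij
  set b := c i₀ a with hb
  have hab : ∀ i, i ≠ p → i ≠ q → c i a = b := by
    intro i hi hi'
    by_cases h1 : i = i₀
    · rw [h1]
    by_cases h2 : i = j₀
    · rw [h2, ← ha]
    exact (hc3 _ hip hiq).apply_eq_of_pairwise (hc3 _ hjp hjq) (hc3 i hi hi') ha' ha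
      (fun h => hij (hcinj _ _ hip hiq hjp hjq h)) (fun h => h1 (hcinj _ _ hip hiq hi hi' h).symm)
      (fun h => h2 (hcinj _ _ hjp hjq hi hi' h).symm)
      (harrow _ _ hip hiq hi hi' (Ne.symm h1)) (harrow _ _ hjp hjq hi hi' (Ne.symm h2))
  have hb1 : ∀ i, i ≠ p → i ≠ q → c i b ≠ b := fun i hi hi' h1 =>
    ha' ((c i).injective ((hab i hi hi').trans h1.symm)).symm
  have hb2 : ∀ i, i ≠ p → i ≠ q → c i b ≠ a := fun i hi hi' h1 => by
    have h2 := (hc3 i hi hi').apply_apply_apply a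
    rw [hab i hi hi', h1, hab i hi hi'] at h2
    exact ha' h2
  -- The images `c i` share the arrow `a ↦ b`. A conjugating permutation has to send `p`, `q`, `i`
  -- to `a`, `b` and the third point of `c i`.
  set f : α → α := fun i => if i = p then a else if i = q then b else c i b with hf
  have hfp : f p = a := if_pos rfl
  have hfq : f q = b := by simp [hf, hpq.symm]
  have hfi : ∀ i, i ≠ p → i ≠ q → f i = c i b := fun i hi hi' => by simp [hf, hi, hi']
  have hcb : ∀ i j, i ≠ p → i ≠ q → j ≠ p → j ≠ q → c i b = c j b → i = j :=
    fun i j hi hi' hj hj' hij => by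
      refine hcinj i j hi hi' hj hj' ((hc3 i hi hi').eq_of_apply_eq (hc3 j hj hj') (x := a) ?_ ?_ ?_)
      · rwa [hab i hi hi']
      · rw [hab i hi hi', hab j hj hj']
      · rw [hab i hi hi', hab j hj hj', hij]
  have hfinj : Function.Injective f := by
    intro i j hij
    grind
  set s : Perm α := Equiv.ofBijective f (Finite.injective_iff_bijective.1 hfinj) with hs
  have hsf : ∀ i, s i = f i := fun _ => rfl
  have hsp : s⁻¹ a = p := by rw [Perm.inv_eq_iff_eq, hsf, hfp]
  have hsq : s⁻¹ b = q := by rw [Perm.inv_eq_iff_eq, hsf, hfq]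
  have hcs : ∀ i, i ≠ p → i ≠ q → c i = s * cyc p q i * s⁻¹ := by
    intro i hi hi'
    have h1 : (s * cyc p q i * s⁻¹) a = b := by
      rw [Perm.mul_apply, Perm.mul_apply, hsp, cyc_apply_left hpq hi.symm, hsf, hfq]
    have h2 : (s * cyc p q i * s⁻¹) b = c i b := by
      rw [Perm.mul_apply, Perm.mul_apply, hsq, cyc_apply_middle hi.symm hi'.symm, hsf, hfi i hi hi']
    refine (hc3 i hi hi').eq_of_apply_eq (x := a) ?_ ?_ ?_ ?_
    · rw [Perm.IsThreeCycle, cycleType_conj]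
      exact isThreeCycle_cyc hpq hi.symm hi'.symm
    · rwa [hab i hi hi']
    · rw [hab i hi hi', h1]
    · rw [hab i hi hi', h1, h2]
  refine ⟨s, fun g => ?_⟩
  set H := ((alternatingGroup α).subtype.comp θ.toMonoidHom).eqLocus
    ((MulAut.conj s).toMonoidHom.comp (alternatingGroup α).subtype) with hH
  have hle : alternatingGroup α ≤ H.map (alternatingGroup α).subtype :=
    alternatingGroup_le_of_cyc_mem hpq fun i hi hi' =>
      ⟨altCyc p q i, by
        change (θ (altCyc p q i) : Perm α) = s * (altCyc p q i : Perm α) * s⁻¹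
        rw [hX i hi hi', ← hcs i hi hi'], hX i hi hi'⟩
  obtain ⟨g', hg', hgg⟩ := hle g.2
  rw [show g = g' from Subtype.ext hgg.symm]
  exact hg'

end ThreeCycles

/-! ### Counting elements of order 3 -/

theorem three_pow_mul_factorial_lt {j : ℕ} (hj : 2 ≤ j) :
    3 ^ j * (j + 1).factorial < (3 * j).factorial := by
  induction j, hj using Nat.le_induction with
  | base => decide
  | succ j hj ih =>
    have h1 : (3 * (j + 1)).factorial =
        (3 * j + 3) * (3 * j + 2) * (3 * j + 1) * (3 * j).factorial := by
      rw [show 3 * (j + 1) = 3 * j + 1 + 1 + 1 by ring]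
      simp only [Nat.factorial_succ]; ring
    calc 3 ^ (j + 1) * (j + 1 + 1).factorial
        = 3 * (j + 2) * (3 ^ j * (j + 1).factorial) := by
          rw [Nat.factorial_succ (j + 1)]; ring
      _ ≤ (3 * j + 3) * (3 * j + 2) * (3 * j + 1) * (3 ^ j * (j + 1).factorial) := by
          refine Nat.mul_le_mul_right _ ?_
          exact (show 3 * (j + 2) ≤ (3 * j + 3) * (3 * j + 2) by nlinarith).trans
            (Nat.le_mul_of_pos_right _ (by omega))
      _ < (3 * j + 3) * (3 * j + 2) * (3 * j + 1) * (3 * j).factorial :=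
          Nat.mul_lt_mul_of_pos_left ih (by positivity)
      _ = _ := h1.symm

/-- With `m + 3 * k` points, the hypothesis says that there are as many products of `k` disjoint
3-cycles as 3-cycles. The exception is degree 6. -/
theorem eq_of_three_pow_mul_factorial_eq {m k : ℕ} (hk : k ≠ 0)
    (h : m.factorial * 3 ^ k * k.factorial = (m + 3 * k - 3).factorial * 3) :
    k = 1 ∨ (m = 0 ∧ k = 2) := by
  obtain ⟨j, rfl⟩ := Nat.exists_eq_succ_of_ne_zero hk
  rw [show m + 3 * j.succ - 3 = m + 3 * j by omega] at h
  replace h : m.factorial * (3 ^ j * (j + 1).factorial) = (m + 3 * j).factorial := by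
    rw [pow_succ] at h
    linarith
  rcases Nat.lt_or_ge j 2 with hj | hj
  · interval_cases j
    · left; rfl
    · right
      refine ⟨?_, rfl⟩
      simp only [Nat.factorial_succ, show m + 3 * 1 = m + 1 + 1 + 1 by ring] at h
      have hm := Nat.factorial_pos m
      have h1 : (m + 1 + 1 + 1) * ((m + 1 + 1) * (m + 1)) = 6 := by
        apply Nat.eq_of_mul_eq_mul_right hm
        simp at h
        linarith
      by_contra hm0
      have h2 : 4 * (3 * 2) ≤ (m + 1 + 1 + 1) * ((m + 1 + 1) * (m + 1)) :=
        Nat.mul_le_mul (by omega) (Nat.mul_le_mul (by omega) (by omega))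
      omega
  · exfalso
    have h1 := Nat.mul_lt_mul_of_pos_left (three_pow_mul_factorial_lt hj) (Nat.factorial_pos m)
    have h2 := Nat.le_of_dvd (Nat.factorial_pos _) (Nat.factorial_mul_factorial_dvd_factorial_add m (3 * j))
    omega

section OrderThree

variable {α : Type*} [Fintype α] [DecidableEq α] {g h : alternatingGroup α}

theorem cycleType_eq_of_isConj (hc : IsConj g h) : (g : Perm α).cycleType = (h : Perm α).cycleType :=
  isConj_iff_cycleType_eq.1 ((alternatingGroup α).subtype.map_isConj hc)

theorem isConj_iff_cycleType_eq_of_not_centralizer_le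
    (hg : ¬ Subgroup.centralizer {(g : Perm α)} ≤ alternatingGroup α) :
    IsConj g h ↔ (g : Perm α).cycleType = (h : Perm α).cycleType := by
  refine ⟨cycleType_eq_of_isConj, fun hc => ?_⟩
  obtain ⟨y, hy, hyg⟩ := exists_mem_alternatingGroup_conj_eq hg (isConj_of_cycleType_eq hc)
  exact isConj_iff.2 ⟨⟨y, hy⟩, Subtype.ext hyg⟩

theorem isConj_map_iff {G : Type*} [Group G] (θ : MulAut G) {a b : G} :
    IsConj (θ a) (θ b) ↔ IsConj a b := by
  refine ⟨fun h => ?_, fun h => θ.toMonoidHom.map_isConj h⟩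
  have := θ.symm.toMonoidHom.map_isConj h
  simpa using this

theorem exists_cycleType_eq_replicate_three (hg : orderOf g = 3) :
    ∃ k, k ≠ 0 ∧ 3 * k ≤ Fintype.card α ∧ (g : Perm α).cycleType = Multiset.replicate k 3 := by
  have h3 : orderOf (g : Perm α) = 3 := by rw [Subgroup.orderOf_coe, hg]
  obtain ⟨k, hk⟩ := cycleType_prime_order (σ := (g : Perm α)) (by rw [h3]; exact Nat.prime_three)
  rw [h3] at hk
  refine ⟨k + 1, by omega, ?_, hk⟩
  have := sum_cycleType_le (g : Perm α)
  rw [hk, Multiset.sum_replicate, smul_eq_mul] at this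
  omega

theorem card_cycleType_map_eq (θ : MulAut (alternatingGroup α))
    (hg : ¬ Subgroup.centralizer {(g : Perm α)} ≤ alternatingGroup α)
    (hθg : ¬ Subgroup.centralizer {(θ g : Perm α)} ≤ alternatingGroup α) :
    Finset.card {h : alternatingGroup α | (h : Perm α).cycleType = (g : Perm α).cycleType} =
    Finset.card {h : alternatingGroup α | (h : Perm α).cycleType = (θ g : Perm α).cycleType} := by
  refine Finset.card_equiv θ.toEquiv fun h => ?_
  rw [Finset.mem_filter_univ, Finset.mem_filter_univ, eq_comm,
    ← isConj_iff_cycleType_eq_of_not_centralizer_le hg, eq_comm (b := (θ g : Perm α).cycleType)]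
  exact (isConj_map_iff θ).symm.trans (isConj_iff_cycleType_eq_of_not_centralizer_le hθg)

theorem card_cycleType_replicate_three {k : ℕ} (hk : k ≠ 0) (hkα : 3 * k ≤ Fintype.card α) :
    Finset.card {h : alternatingGroup α | (h : Perm α).cycleType = Multiset.replicate k 3} *
      ((Fintype.card α - 3 * k).factorial * 3 ^ k * k.factorial) = (Fintype.card α).factorial := by
  have h1 := AlternatingGroup.card_of_cycleType_mul_eq α (Multiset.replicate k 3)
  rw [if_pos] at h1
  · rw [← h1, Multiset.sum_replicate, Multiset.prod_replicate, Multiset.toFinset_replicate,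
      if_neg hk, Finset.prod_singleton, Multiset.count_replicate_self, smul_eq_mul, mul_comm k 3]
  · rw [Multiset.sum_replicate, smul_eq_mul, Multiset.card_replicate]
    refine ⟨⟨by omega, fun a ha => ?_⟩, ?_⟩
    · rw [Multiset.eq_of_mem_replicate ha]; norm_num
    · rw [← Nat.mul_succ]
      exact Even.mul_left (by decide) k

/-- An automorphism of an alternating group of degree at least 6 maps 3-cycles to 3-cycles, or
the degree is 6 and it maps them to products of two disjoint 3-cycles. -/
theorem cycleType_map_of_isThreeCycle (θ : MulAut (alternatingGroup α))
    (hα : 5 < Fintype.card α) (hg : (g : Perm α).IsThreeCycle) :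
    (θ g : Perm α).IsThreeCycle ∨
      Fintype.card α = 6 ∧ (θ g : Perm α).cycleType = Multiset.replicate 2 3 := by
  have hg3 : orderOf (θ g) = 3 := by
    rw [MulEquiv.orderOf_eq, ← Subgroup.orderOf_coe, hg.orderOf]
  obtain ⟨k, hk, hkα, hkg⟩ := exists_cycleType_eq_replicate_three hg3
  have hg' : (g : Perm α).cycleType = Multiset.replicate 1 3 := hg
  -- Neither class splits in `A_n`, so `θ` is a bijection between full cycle-type classes.
  have h1 := card_cycleType_map_eq θ (g := g) (not_centralizer_le_of_replicate (by omega) hg')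
    (not_centralizer_le_of_replicate (by omega) hkg)
  rw [hg', hkg] at h1
  have h2 := card_cycleType_replicate_three (α := α) one_ne_zero (by omega)
  have h3 := card_cycleType_replicate_three hk hkα
  rw [← h2, h1] at h3
  have h4 : 0 < Finset.card {h : alternatingGroup α | (h : Perm α).cycleType =
      Multiset.replicate k 3} := Finset.card_pos.2 ⟨θ g, by simp [hkg]⟩
  have h5 := Nat.eq_of_mul_eq_mul_left h4 h3
  have h6 := eq_of_three_pow_mul_factorial_eq (m := Fintype.card α - 3 * k) hk (by
    rw [h5, show Fintype.card α - 3 * k + 3 * k - 3 = Fintype.card α - 3 * 1 by omega]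
    simp)
  rcases h6 with rfl | ⟨h6, rfl⟩
  · exact Or.inl hkg
  · exact Or.inr ⟨by omega, hkg⟩

end OrderThree

/-! ### Automorphisms of prime-power order -/

section FixedPoints

variable {G : Type*} [Group G] {θ : MulAut G}

/-- The permutation of the left cosets of `Fix θ` induced by `θ`. -/
def fixCosetPerm (θ : MulAut G) : Perm (G ⧸ fixSubgroup θ) where
  toFun := Quotient.map' θ fun a b hab => by
    rw [QuotientGroup.leftRel_apply] at hab ⊢
    rw [← map_inv, ← map_mul, mem_fixSubgroup.1 hab]
    exact hab
  invFun := Quotient.map' θ.symm fun a b hab => by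
    rw [QuotientGroup.leftRel_apply] at hab ⊢
    rw [← map_inv, ← map_mul, θ.symm_apply_eq.2 (mem_fixSubgroup.1 hab).symm]
    exact hab
  left_inv x := by
    induction x using Quotient.inductionOn'
    simp
  right_inv x := by
    induction x using Quotient.inductionOn'
    simp

theorem fixCosetPerm_pow_mk (k : ℕ) (g : G) :
    (fixCosetPerm θ ^ k) (g : G ⧸ fixSubgroup θ) = ((θ ^ k) g : G) := by
  induction k with
  | zero => rfl
  | succ k ih => rw [pow_succ', pow_succ', Perm.mul_apply, ih]; rfl

/-- If `θ` has `p`-power order and fixes a single coset of `Fix θ`, then every `p`-subgroup is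
conjugate to a subgroup of `Fix θ`. -/
theorem exists_conj_mem_fixSubgroup [Finite G] {p : ℕ} [hp : Fact p.Prime]
    (hθ : HasUniqueFixedCoset θ) {n : ℕ} (hn : θ ^ p ^ n = 1) {V : Subgroup G}
    (hV : IsPGroup p V) : ∃ g : G, ∀ v ∈ V, g⁻¹ * v * g ∈ fixSubgroup θ := by
  -- Modulo `p`, the number of cosets is the number of those fixed by `θ`; the trivial coset is the
  -- only one.
  have hdvd : ¬ p ∣ Nat.card (G ⧸ fixSubgroup θ) := by
    intro h
    have := Fintype.ofFinite (G ⧸ fixSubgroup θ)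
    rw [Nat.card_eq_fintype_card] at h
    obtain ⟨b, hb, hb1⟩ := exists_fixed_point_of_prime' (n := n) h (σ := fixCosetPerm θ) (by
      ext x
      induction x using Quotient.inductionOn' with | _ g
      exact (fixCosetPerm_pow_mk _ g).trans (by rw [hn]; rfl))
      (a := ((1 : G) : G ⧸ fixSubgroup θ)) (by
        rw [← pow_one (fixCosetPerm θ), fixCosetPerm_pow_mk, pow_one, map_one])
    induction b using Quotient.inductionOn' with | _ z
    apply hb1
    have h1 : ((θ z : G) : G ⧸ fixSubgroup θ) = z := hb
    have h2 := hθ z (QuotientGroup.eq.1 h1.symm)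
    exact (QuotientGroup.eq.2 (by simpa using h2)).symm
  obtain ⟨b, hb⟩ := hV.nonempty_fixed_point_of_prime_not_dvd_card (G ⧸ fixSubgroup θ) hdvd
  induction b using Quotient.inductionOn' with | _ g
  refine ⟨g, fun v hv => ?_⟩
  have h1 : ((v * g : G) : G ⧸ fixSubgroup θ) = g := hb ⟨v, hv⟩
  have h2 := QuotientGroup.eq.1 h1.symm
  rwa [← mul_assoc] at h2

theorem isPGroup_two_zpowers_sup {v w : G} (hv : v ^ 2 = 1) (hw : w ^ 2 = 1) (h : Commute v w) :
    IsPGroup 2 (Subgroup.zpowers v ⊔ Subgroup.zpowers w : Subgroup G) := by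
  have key : ∀ x : G, x ^ 2 = 1 → IsPGroup 2 (Subgroup.zpowers x) := by
    intro x hx
    refine IsPGroup.of_card_dvd_pow (n := 1) ?_
    rw [Nat.card_zpowers, pow_one]
    exact orderOf_dvd_of_pow_eq_one hx
  refine (key v hv).to_sup_of_normal_left' (key w hw) ?_
  rw [Subgroup.zpowers_le]
  refine Subgroup.centralizer_le_normalizer _ (Subgroup.mem_centralizer_iff.2 ?_)
  rintro _ ⟨k, rfl⟩
  exact h.zpow_left k

end FixedPoints

/-! ### Exotic automorphisms in degree 6 -/

section DegreeSix

theorem mem_zpowers_of_commute_of_orderOf_eq_five {q u : Perm (Fin 6)} (hq : orderOf q = 5)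
    (h : Commute u q) : u ∈ Subgroup.zpowers q := by
  obtain ⟨k, hk⟩ := cycleType_prime_order (σ := q) (by rw [hq]; exact Nat.prime_five)
  have h5 : q.cycleType = {5} := by
    have := sum_cycleType_le q
    rw [hk, hq, Multiset.sum_replicate, smul_eq_mul, Fintype.card_fin] at this
    obtain rfl : k = 0 := by omega
    rw [hk, hq]; rfl
  have hle : Subgroup.zpowers q ≤ Subgroup.centralizer {q} := by
    rw [Subgroup.zpowers_le, Subgroup.mem_centralizer_singleton_iff]
  have hcard : Nat.card (Subgroup.centralizer {q}) ≤ Nat.card (Subgroup.zpowers q) := by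
    rw [nat_card_centralizer, Nat.card_zpowers, hq, h5]
    simp
  rw [Subgroup.eq_of_le_of_card_ge hle hcard, Subgroup.mem_centralizer_singleton_iff]
  exact h

variable {θ : MulAut (alternatingGroup (Fin 6))}

/-- Some even `z` inverts `q`, and so does `θ z`. Thus `z⁻¹ θ(z)` centralizes `q`, lies in `⟨q⟩ ≤
Fix θ`, and forces `θ z = z`. Then `z` commutes with `s`, hence with `q`, which is absurd. -/
theorem orderOf_ne_five_of_hasUniqueFixedCoset (hθ : HasUniqueFixedCoset θ) {s : Perm (Fin 6)}
    (hs : ∀ g : alternatingGroup (Fin 6), (θ (θ g) : Perm (Fin 6)) = s * g * s⁻¹)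
    {q : alternatingGroup (Fin 6)} (hqθ : θ q = q) (hqs : (q : Perm (Fin 6)) ∈ Subgroup.zpowers s) :
    orderOf q ≠ 5 := by
  intro hq
  have hq' : orderOf (q : Perm (Fin 6)) = 5 := by rw [Subgroup.orderOf_coe, hq]
  obtain ⟨y, hy, hyq⟩ := exists_mem_alternatingGroup_conj_eq_pow_four
    (s := (q : Perm (Fin 6))) (by rw [hq']; decide)
  set z : alternatingGroup (Fin 6) := ⟨y, hy⟩ with hz
  have hzq : z * q * z⁻¹ = q ^ 4 := Subtype.ext hyq
  have hθz : θ z * q * (θ z)⁻¹ = q ^ 4 := by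
    have := congrArg θ hzq
    rwa [map_mul, map_mul, map_pow, map_inv, hqθ] at this
  have hcom : Commute (z⁻¹ * θ z) q := by
    have h1 : z⁻¹ * (q ^ 4) * z = q := by rw [← hzq]; group
    have h2 : (z⁻¹ * θ z) * q * (z⁻¹ * θ z)⁻¹ = q := by
      calc _ = z⁻¹ * (θ z * q * (θ z)⁻¹) * z := by group
        _ = q := by rw [hθz, h1]
    exact mul_inv_eq_iff_eq_mul.1 h2
  obtain ⟨k, hk⟩ := mem_zpowers_of_commute_of_orderOf_eq_five hq'
    (u := ((z⁻¹ * θ z : alternatingGroup (Fin 6)) : Perm (Fin 6))) (congrArg Subtype.val hcom)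
  have hk' : z⁻¹ * θ z = q ^ k := Subtype.ext hk.symm
  have hfix := mem_fixSubgroup.1 (hθ z (by rw [hk', mem_fixSubgroup, map_zpow, hqθ]))
  have h1 := hs z
  rw [hfix, hfix] at h1
  have hys : Commute s y := (eq_mul_inv_iff_mul_eq.1 h1).symm
  obtain ⟨m, hm⟩ := hqs
  have hyq' : Commute y (q : Perm (Fin 6)) := by
    rw [← hm]
    exact (hys.zpow_left m).symm
  rw [hyq'.eq, mul_inv_cancel_right] at hyq
  have h3 : (q : Perm (Fin 6)) ^ 3 = 1 := by
    refine mul_right_cancel (b := (q : Perm (Fin 6))) ?_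
    rw [one_mul, ← pow_succ, ← hyq]
  have := orderOf_dvd_of_pow_eq_one h3
  rw [hq'] at this
  omega

/-- `θ` commutes with `θ ^ 4`, which is conjugation by `r`; so `r` and `θ r` induce the same
conjugation, and the center is trivial. -/
theorem map_sq_eq_of_map_map_eq_conj {s : Perm (Fin 6)}
    (hs : ∀ g : alternatingGroup (Fin 6), (θ (θ g) : Perm (Fin 6)) = s * g * s⁻¹)
    {r : alternatingGroup (Fin 6)} (hr : (r : Perm (Fin 6)) = s ^ 2) : θ r = r := by
  have h4 : ∀ g, θ (θ (θ (θ g))) = r * g * r⁻¹ := fun g => Subtype.ext (by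
    rw [hs, hs]
    simp only [Subgroup.coe_mul, Subgroup.coe_inv, hr, sq, mul_inv_rev, mul_assoc])
  have hc : r⁻¹ * θ r ∈ Subgroup.center (alternatingGroup (Fin 6)) := by
    rw [Subgroup.mem_center_iff]
    intro g
    obtain ⟨g, rfl⟩ := θ.surjective g
    have h5 : θ r * θ g * (θ r)⁻¹ = r * θ g * r⁻¹ := by
      rw [← h4, ← map_inv, ← map_mul, ← map_mul, ← h4]
    have h6 : θ r * θ g = r * θ g * r⁻¹ * θ r := by rw [← h5]; group
    rw [mul_assoc, h6]; group
  rw [alternatingGroup.center_eq_bot (by simp), Subgroup.mem_bot, inv_mul_eq_one] at hc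
  exact hc.symm

theorem apply_ne_self_of_cycleType {σ : Perm (Fin 6)} (h : σ.cycleType = Multiset.replicate 2 3)
    (x : Fin 6) : σ x ≠ x := by
  have h1 : σ.support = Finset.univ := by
    rw [← Finset.card_eq_iff_eq_univ, ← sum_cycleType, h]
    rfl
  rw [← mem_support, h1]
  exact Finset.mem_univ x

/-- An automorphism of the alternating group of degree 6 that fixes a conjugate of a Klein
four-group with two fixed points maps some 3-cycle to a permutation with a fixed point. -/
theorem exists_isThreeCycle_map_apply_eq (g : alternatingGroup (Fin 6))
    {v w : alternatingGroup (Fin 6)} (hv : (v : Perm (Fin 6)) = swap 0 1 * swap 2 3)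
    (hw : (w : Perm (Fin 6)) = swap 0 2 * swap 1 3)
    (hvθ : θ (g * v * g⁻¹) = g * v * g⁻¹) (hwθ : θ (g * w * g⁻¹) = g * w * g⁻¹) :
    ∃ c : alternatingGroup (Fin 6), (c : Perm (Fin 6)).IsThreeCycle ∧
      ∃ x, (θ c : Perm (Fin 6)) x = x := by
  have hc : (cyc 0 1 2 : Perm (Fin 6)).IsThreeCycle :=
    isThreeCycle_cyc (by decide) (by decide) (by decide)
  set c : alternatingGroup (Fin 6) := ⟨cyc 0 1 2, hc.mem_alternatingGroup⟩ with hcdef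
  have hcv : c * v * c⁻¹ = v * w := by
    rw [mul_inv_eq_iff_eq_mul]
    refine Subtype.ext ?_
    simp only [Subgroup.coe_mul, hv, hw, hcdef]
    decide
  have hc' : ((g * c * g⁻¹ : alternatingGroup (Fin 6)) : Perm (Fin 6)).IsThreeCycle := by
    simp only [Subgroup.coe_mul, Subgroup.coe_inv]
    rw [IsThreeCycle, cycleType_conj]
    exact hc
  refine ⟨g * c * g⁻¹, hc', (g : Perm (Fin 6)) 4, ?_⟩
  set d : alternatingGroup (Fin 6) := g⁻¹ * θ (g * c * g⁻¹) * g with hd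
  have hdv : d * v = v * w * d := by
    have h1 : (g * c * g⁻¹) * (g * v * g⁻¹) = (g * v * g⁻¹) * (g * w * g⁻¹) * (g * c * g⁻¹) := by
      rw [mul_inv_eq_iff_eq_mul] at hcv
      calc _ = g * (c * v) * g⁻¹ := by group
        _ = _ := by rw [hcv]; group
    have h2 := congrArg θ h1
    rw [map_mul θ (g * c * g⁻¹), map_mul θ _ (g * c * g⁻¹), map_mul θ (g * v * g⁻¹), hvθ, hwθ] at h2
    calc d * v = g⁻¹ * (θ (g * c * g⁻¹) * (g * v * g⁻¹)) * g := by rw [hd]; group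
      _ = v * w * d := by rw [h2, hd]; group
  -- Since `d` conjugates `v` to `v * w`, it maps the fixed points `4`, `5` of `v` to those of `v *
  -- w`, again `4` and `5`. As `d ^ 3 = 1`, it cannot swap them.
  have hdfix : ∀ x : Fin 6, (v : Perm (Fin 6)) x = x →
      (d : Perm (Fin 6)) x = 4 ∨ (d : Perm (Fin 6)) x = 5 := by
    intro x hx
    have h1 := congrArg (fun a : alternatingGroup (Fin 6) => (a : Perm (Fin 6)) x) hdv
    simp only [Subgroup.coe_mul, Perm.mul_apply] at h1
    rw [hx, hv, hw] at h1
    revert h1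
    generalize (d : Perm (Fin 6)) x = y
    revert y
    decide
  have hd4 := hdfix 4 (by rw [hv]; decide)
  have hd5 := hdfix 5 (by rw [hv]; decide)
  have hd3 : (d : Perm (Fin 6)) ((d : Perm (Fin 6)) ((d : Perm (Fin 6)) 4)) = 4 := by
    have h1 : (g * c * g⁻¹) ^ 3 = 1 := by
      refine Subtype.ext ?_
      rw [Subgroup.coe_pow, ← hc'.orderOf, pow_orderOf_eq_one]
      rfl
    have h2 : d ^ 3 = 1 := by
      have h3 := congrArg θ h1
      rw [map_pow, map_one] at h3
      calc d ^ 3 = g⁻¹ * θ (g * c * g⁻¹) ^ 3 * g := by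
            rw [hd, show g⁻¹ * θ (g * c * g⁻¹) * g = g⁻¹ * θ (g * c * g⁻¹) * g⁻¹⁻¹ by rw [inv_inv],
              conj_pow, inv_inv]
        _ = 1 := by rw [h3]; group
    exact congrArg (fun a : alternatingGroup (Fin 6) => (a : Perm (Fin 6)) 4) h2
  have hd44 : (d : Perm (Fin 6)) 4 = 4 := by
    rcases hd4 with h | h
    · exact h
    · rcases hd5 with h' | h'
      · rwa [h, h'] at hd3
      · rw [h, h', h'] at hd3
        exact absurd hd3 (by decide)
  have h6 : θ (g * c * g⁻¹) * g = g * d := by rw [hd]; group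
  have h7 := congrArg (fun a : alternatingGroup (Fin 6) => (a : Perm (Fin 6)) 4) h6
  simp only [Subgroup.coe_mul, Perm.mul_apply] at h7
  rw [hd44] at h7
  exact h7

theorem map_isThreeCycle_of_hasUniqueFixedCoset (hθ : HasUniqueFixedCoset θ)
    (g : alternatingGroup (Fin 6)) (hg : (g : Perm (Fin 6)).IsThreeCycle) :
    (θ g : Perm (Fin 6)).IsThreeCycle := by
  rcases cycleType_map_of_isThreeCycle θ (by simp) hg with h | ⟨-, hg'⟩
  · exact h
  exfalso
  have hconj : ∀ {a b : alternatingGroup (Fin 6)},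
      (a : Perm (Fin 6)).cycleType = Multiset.replicate 2 3 →
      (b : Perm (Fin 6)).cycleType = Multiset.replicate 2 3 → IsConj a b := fun {a b} ha hb =>
    (isConj_iff_cycleType_eq_of_not_centralizer_le
      (not_centralizer_le_of_replicate (by simp) ha)).2 (ha.trans hb.symm)
  have h23 : ∀ a : alternatingGroup (Fin 6), (a : Perm (Fin 6)).IsThreeCycle →
      (a : Perm (Fin 6)).cycleType ≠ Multiset.replicate 2 3 := fun a ha h => by
    rw [ha.cycleType] at h
    exact absurd (congrArg Multiset.card h) (by simp)
  have hA : ∀ a : alternatingGroup (Fin 6), (a : Perm (Fin 6)).IsThreeCycle →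
      (θ a : Perm (Fin 6)).cycleType = Multiset.replicate 2 3 := fun a ha => by
    rw [← hg']
    exact cycleType_eq_of_isConj ((isConj_map_iff θ).2
      (alternatingGroup.isThreeCycle_isConj (by simp) ha hg))
  have hB : ∀ a : alternatingGroup (Fin 6),
      (a : Perm (Fin 6)).cycleType = Multiset.replicate 2 3 →
      (θ a : Perm (Fin 6)).cycleType ≠ Multiset.replicate 2 3 := fun a ha h => by
    have h1 := (isConj_map_iff θ).1 (hconj hg' h)
    exact h23 g hg ((cycleType_eq_of_isConj h1).trans ha)
  have h3 : ∀ a : alternatingGroup (Fin 6), orderOf a = 3 →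
      (a : Perm (Fin 6)).IsThreeCycle ∨
        (a : Perm (Fin 6)).cycleType = Multiset.replicate 2 3 := fun a ha => by
    obtain ⟨k, hk, hk6, hka⟩ := exists_cycleType_eq_replicate_three ha
    rw [Fintype.card_fin] at hk6
    obtain rfl | rfl : k = 1 ∨ k = 2 := by omega
    · exact Or.inl hka
    · exact Or.inr hka
  have hne3 : ∀ a, θ a = a → orderOf a ≠ 3 := fun a ha ha3 => by
    rcases h3 a ha3 with h | h
    · have h1 := hA a h
      rw [ha] at h1
      exact h23 a h h1
    · have h1 := hB a h
      rw [ha] at h1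
      exact h1 h
  -- An exotic `θ` swaps the two classes of elements of order 3, so it fixes none of these elements
  -- and `θ ^ 2` preserves 3-cycles. As `s` may be odd, `r = s ^ 2` is used in `A_6`.
  obtain ⟨s, hs⟩ := exists_perm_conj_of_map_isThreeCycle (θ := θ * θ) (by simp) fun a ha =>
    (h3 (θ (θ a)) (by
      rw [MulEquiv.orderOf_eq, MulEquiv.orderOf_eq, ← Subgroup.orderOf_coe, ha.orderOf])).resolve_right
      (hB _ (hA a ha))
  replace hs : ∀ a : alternatingGroup (Fin 6), (θ (θ a) : Perm (Fin 6)) = s * a * s⁻¹ := hs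
  set r : alternatingGroup (Fin 6) := ⟨s ^ 2, by simp [mem_alternatingGroup]⟩ with hr
  have hrθ : θ r = r := map_sq_eq_of_map_map_eq_conj hs rfl
  have hrpow : ∀ k : ℕ, θ (r ^ k) = r ^ k := fun k => by rw [map_pow, hrθ]
  have hr3 : ¬ 3 ∣ orderOf r := fun h =>
    hne3 (r ^ (orderOf r / 3)) (hrpow _) (orderOf_pow_orderOf_div (orderOf_pos r).ne' h)
  have hr5 : ¬ 5 ∣ orderOf r := fun h =>
    orderOf_ne_five_of_hasUniqueFixedCoset hθ hs (hrpow (orderOf r / 5))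
      (by
        rw [Subgroup.coe_pow, hr]
        exact pow_mem (pow_mem (Subgroup.mem_zpowers s) 2) _)
      (orderOf_pow_orderOf_div (orderOf_pos r).ne' h)
  have hr16 : orderOf r ∣ 2 ^ 4 := by
    have h1 : orderOf r ∣ 720 := by
      rw [← Subgroup.orderOf_coe]
      have := orderOf_dvd_natCard (r : Perm (Fin 6))
      rwa [Nat.card_perm, Nat.card_eq_fintype_card, Fintype.card_fin] at this
    have h2 : (orderOf r).Coprime (3 ^ 2) :=
      ((Nat.Prime.coprime_iff_not_dvd Nat.prime_three).2 hr3).symm.pow_right 2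
    have h3 : (orderOf r).Coprime 5 :=
      ((Nat.Prime.coprime_iff_not_dvd Nat.prime_five).2 hr5).symm
    exact (h2.mul_right h3).dvd_of_dvd_mul_right (h1.trans (by norm_num))
  have hθ64 : θ ^ 2 ^ 6 = 1 := by
    have h1 : ∀ a, (θ ^ 4) a = r * a * r⁻¹ := fun a => Subtype.ext (by
      change (θ (θ (θ (θ a))) : Perm (Fin 6)) = _
      rw [hs, hs]
      simp only [Subgroup.coe_mul, Subgroup.coe_inv, hr, sq, mul_inv_rev, mul_assoc])
    have h2 : θ ^ 4 = MulAut.conj r := by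
      ext1 a
      exact h1 a
    rw [show 2 ^ 6 = 4 * 2 ^ 4 by norm_num, pow_mul, h2, ← map_pow,
      orderOf_dvd_iff_pow_eq_one.1 hr16, map_one]
  have hvmem : (swap 0 1 * swap 2 3 : Perm (Fin 6)) ∈ alternatingGroup (Fin 6) := by
    rw [mem_alternatingGroup]; decide
  have hwmem : (swap 0 2 * swap 1 3 : Perm (Fin 6)) ∈ alternatingGroup (Fin 6) := by
    rw [mem_alternatingGroup]; decide
  obtain ⟨x, hx⟩ := exists_conj_mem_fixSubgroup hθ hθ64 (isPGroup_two_zpowers_sup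
    (v := (⟨_, hvmem⟩ : alternatingGroup (Fin 6))) (w := ⟨_, hwmem⟩)
    (Subtype.ext (by simp only [Subgroup.coe_pow, Subgroup.coe_one]; decide))
    (Subtype.ext (by simp only [Subgroup.coe_pow, Subgroup.coe_one]; decide))
    (Subtype.ext (by simp only [Subgroup.coe_mul]; decide)))
  obtain ⟨c, hc, y, hy⟩ := exists_isThreeCycle_map_apply_eq (θ := θ) x⁻¹
    (v := ⟨_, hvmem⟩) (w := ⟨_, hwmem⟩) rfl rfl
    (by
      rw [inv_inv]
      exact hx _ (Subgroup.mem_sup_left (Subgroup.mem_zpowers _)))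
    (by
      rw [inv_inv]
      exact hx _ (Subgroup.mem_sup_right (Subgroup.mem_zpowers _)))
  exact apply_ne_self_of_cycleType (hA c hc) y hy

end DegreeSix

/-! ### Conclusion -/

theorem eq_one_of_hasUniqueFixedCoset {n : ℕ} (hn : 5 < n) {θ : MulAut (alternatingGroup (Fin n))}
    (hθ : HasUniqueFixedCoset θ) : θ = 1 := by
  have h3 : ∀ g : alternatingGroup (Fin n), (g : Perm (Fin n)).IsThreeCycle →
      (θ g : Perm (Fin n)).IsThreeCycle := by
    intro g hg
    by_cases h6 : n = 6
    · subst h6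
      exact map_isThreeCycle_of_hasUniqueFixedCoset hθ g hg
    · refine (cycleType_map_of_isThreeCycle θ (by simpa using hn) hg).resolve_right fun h => h6 ?_
      simpa using h.1
  obtain ⟨s, hs⟩ := exists_perm_conj_of_map_isThreeCycle (by rw [Fintype.card_fin]; omega) h3
  have hs1 : s = 1 := by
    by_contra hne
    obtain ⟨y, hy, hys, hcom⟩ :=
      exists_mem_alternatingGroup_commute_conj (by simpa using hn) hne
    have hfix : (⟨y, hy⟩ : alternatingGroup (Fin n)) ∈ fixSubgroup θ := by
      -- Here `y θ(y)⁻¹ = (y s y⁻¹) s⁻¹` commutes with `s`.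
      refine hθ _ (inv_mul_map_mem_fixSubgroup_iff.2 (mem_fixSubgroup.2 (Subtype.ext ?_)))
      rw [hs]
      simp only [Subgroup.coe_mul, Subgroup.coe_inv, hs]
      have h1 : y * (s * y * s⁻¹)⁻¹ = (y * s * y⁻¹) * s⁻¹ := by group
      rw [h1, mul_inv_eq_iff_eq_mul]
      exact hcom.mul_right (Commute.refl s).inv_right
    have h1 := congrArg Subtype.val (mem_fixSubgroup.1 hfix)
    rw [hs, mul_inv_eq_iff_eq_mul] at h1
    exact hys (by rw [← h1, mul_inv_cancel_right])
  ext1 g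
  refine Subtype.ext ?_
  rw [hs, hs1]
  simp

theorem prime_dvd_card_alternatingGroup {n p : ℕ} (hn : 3 < n) (hp : p.Prime)
    (h : p ∣ n.factorial) : p ∣ Nat.card (alternatingGroup (Fin n)) := by
  have : Nontrivial (Fin n) := Fin.nontrivial_iff_two_le.2 (by omega)
  have h2 := two_mul_nat_card_alternatingGroup (α := Fin n)
  rw [Nat.card_perm, Nat.card_eq_fintype_card (α := Fin n), Fintype.card_fin] at h2
  by_cases hp2 : p = 2
  · subst hp2
    -- Halving `n!` costs one factor 2, so two are needed.
    have h4 : 2 * 2 ∣ n.factorial := Nat.dvd_factorial (by norm_num) (by omega)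
    rw [← h2] at h4
    exact Nat.dvd_of_mul_dvd_mul_left (by norm_num) h4
  · rw [← h2] at h
    exact (hp.dvd_mul.1 h).resolve_left fun h' =>
      hp2 ((Nat.prime_dvd_prime_iff_eq hp Nat.prime_two).1 h')

theorem mainTheorem11 (n : ℕ) (hn : 5 < n) (t : ℕ) (ht : 1 ≤ t)
    (θ : MulAut (alternatingGroup (Fin n))) :
    IsSuperfaithful (PowerQuandle (alternatingGroup (Fin n)) t θ) ↔
      θ = 1 ∧ Nat.Coprime t n.factorial := by
  rw [isSuperfaithful_cosetQuandle_iff]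
  constructor
  · intro h
    obtain rfl := eq_one_of_hasUniqueFixedCoset hn (hasUniqueFixedCoset_of_shiftAut ht h)
    refine ⟨rfl, Nat.coprime_of_dvd fun p hp hpt hpn => ?_⟩
    have := Fact.mk hp
    obtain ⟨a, ha⟩ := exists_prime_orderOf_dvd_card' p
      (prime_dvd_card_alternatingGroup (by omega) hp hpn)
    have ha1 : a = 1 := eq_one_of_hasUniqueFixedCoset_shiftAut ht h (y := 1) rfl (by
      rw [map_one, inv_one, mul_one, ← orderOf_dvd_iff_pow_eq_one, ha]
      exact hpt)
    rw [ha1, orderOf_one] at ha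
    exact hp.one_lt.ne ha
  · rintro ⟨rfl, hco⟩
    refine hasUniqueFixedCoset_shiftAut_one ht fun a ha => ?_
    rw [← orderOf_eq_one_iff]
    refine Nat.eq_one_of_dvd_coprimes hco (orderOf_dvd_of_pow_eq_one ha) ?_
    rw [← Subgroup.orderOf_coe]
    have := orderOf_dvd_natCard (a : Perm (Fin n))
    rwa [Nat.card_perm, Nat.card_eq_fintype_card, Fintype.card_fin] at this
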